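/- Conventions. Let $\mathcal L$ be a finite relational language of maximum arity $k\ge 2$ and $\mathcal H$ a class of finite $\mathcal L$-structures. $\mathcal H$ is a hereditary $\mathcal L$-property if it is nonempty and closed under isomorphism and substructures, and it is nontrivial if it has members of arbitrarily large finite size. Let $S_k(\mathcal H)$ be the set of complete quantifier-free $k$-types $p(x_1,\dots,x_k)$ realized by a tuple of $k$ distinct elements in some member of $\mathcal H$, and let $\mathcal L_{\mathcal H}=\{R_p : p\in S_k(\mathcal H)\}$, with each $R_p$ a $k$-ary relation symbol. Write $c_v$ for a constant naming $v$. For an $\mathcal L_{\mathcal H}$-structure $M$ with domain $V$ and $A\in\binom Vk$, let $Ch_M(A)$ be the set of all $p(c_{a_1},\dots,c_{a_k})$ with $\{a_1,\dots,a_k\}=A$ and $M\models R_p(a_1,\dots,a_k)$. * $M$ is *complete* if $Ch_M(A)\ne\emptyset$ for every $A\in\binom Vk$. It is a *template* if moreover no $R_p$ holds of a tuple with a repeated entry, and, whenever $p(\bar x)=p'(\mu(\bar x))$ for a permutation $\mu$ of the coordinates, $M\models R_p(\bar a)\Leftrightarrow M\models R_{p'}(\mu(\bar a))$ for all tuples $\bar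 a$ of distinct elements. * A *choice function* for $M$ assigns to each $A\in\binom Vk$ an element $\chi(A)\in Ch_M(A)$; it *chooses* the $\mathcal L$-structure $N$ with domain $V$ if $\chi(A)$ is the quantifier-free diagram of $A$ in $N$ for all $A\in\binom Vk$. Let $\mathrm{sub}(M)$ be the number of $\mathcal L$-structures with domain $V$ chosen by some choice function for $M$. $M$ is *$\mathcal H$-random* if it is complete and each of its choice functions chooses a member of $\mathcal H$. * $\mathcal R(n,\mathcal H)$ is the class of $\mathcal H$-random templates of size $n$, $\mathrm{ex}(n,\mathcal H)=\max\{\mathrm{sub}(M):M\in\mathcal R(n,\mathcal H)\}$ (with $\max\emptyset=0$), and $\mathcal R_{ex}(n,\mathcal H)$ is the class of *extremal* templates, i.e. those $M\in\mathcal R(n,\mathcal H)$ with $\mathrm{sub}(M)=\mathrm{ex}(n,\mathcal H)$. * Two $\mathcal L_{\mathcal H}$-structures $M,M'$ with the same $n$-element domain $V$ are *$\delta$-close* if at most $\delta\binom nk$ sets $A\in\binom Vk$ have an enumeration $\bar a$ whose quantifier-free types in $M$ and in $M'$ differ. * A nontrivial $\mathcal H$ *has a stability theorem* if for every $\delta>0$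 there are $\varepsilon>0$ and $N$ such that, for all $n>N$, every $M\in\mathcal R(n,\mathcal H)$ with $\mathrm{sub}(M)\ge \mathrm{ex}(n,\mathcal H)^{1-\varepsilon}$ is $\delta$-close to some $M'\in\mathcal R_{ex}(n,\mathcal H)$. **Theorem.** Let $r\ge 2$ be even, let $\mathcal L_r=\{R_1,\dots,R_r\}$ with all $R_i$ binary, and let $\mathcal P$ be the class of finite metric spaces in which all distances between distinct points lie in $\{1,\dots,r\}$, viewed as $\mathcal L_r$-structures by letting $R_i(x,y)$ hold if and only if $d(x,y)=i$. Then $\mathcal P$ is a hereditary $\mathcal L_r$-property, and $\mathcal P$ is nontrivial and has a stability theorem. Moreover, for every finite set $V$ with $|V|\ge 3$ there is exactly one extremal $\mathcal P$-random template with domain $V$. For all distinct $x,y\in V$, the set of distances that it allows between $x$ and $y$, namely the set of $i$ such that $R_{p_i}(x,y)$ or $R_{p_i}(y,x)$ holds in it, where $p_i\in S_2(\mathcal P)$ is the type saying that the distance is $i$, is exactly $\{r/2,\,r/2+1,\dots,r\}$. (Hence, for large $n$, every $\mathcal P$-random template of size $n$ with $\mathrm{sub}\ge\mathrm{ex}^{1-\varepsilon}$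 is $\delta$-close to this unique extremal template.) -/

import Mathlib

open FirstOrder CategoryTheory

namespace HereditaryTemplates

/-! ## Quantifier-free types and diagrams -/

section Types

variable {L : FirstOrder.Language.{0, 0}}

/-- The maximum arity of a relation symbol of the finite relational language `L`. -/
noncomputable def maxArity (L : FirstOrder.Language.{0, 0}) : ℕ :=
  sSup {n | Nonempty (L.Relations n)}

/-- The quantifier-free type of the tuple `a` in the structure `M`. -/
def qftp {V : Type} (M : L.Structure V) {l : ℕ} (a : Fin l → V) : Set (L.Formula (Fin l)) :=
  {φ | φ.IsQF ∧ φ.Realize a}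

/-- The set of complete proper quantifier-free `l`-types realized in some element of `H`.
Such a type is exactly the quantifier-free type of a tuple of distinct elements. -/
def typeSpace (l : ℕ) (H : Set (Bundled.{0} L.Structure)) : Set (Set (L.Formula (Fin l))) :=
  {p | ∃ M ∈ H, ∃ a : Fin l → M, Function.Injective a ∧ p = qftp M.str a}

/-- `p(c_a)`: substitute the constants named by the tuple `a` into the type `p(x)`.
Sentences over `L` with constants from `V` are represented by formulas with variables in `V`
(see `FirstOrder.Language.Formula.equivSentence`). -/
def subst {V : Type} {l : ℕ} (p : Set (L.Formula (Fin l))) (a : Fin l → V) :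
    Set (L.Formula V) :=
  FirstOrder.Language.Formula.relabel a '' p

/-- The diagram of `A` in `N`: all `φ(c_a)` with `φ` quantifier-free, `a` a tuple from `A`, and
`N ⊨ φ(a)`. -/
def diag {V : Type} (N : L.Structure V) (A : Finset V) : Set (L.Formula V) :=
  {ψ | ∃ (l : ℕ) (φ : L.Formula (Fin l)) (a : Fin l → V),
    φ.IsQF ∧ (∀ i, a i ∈ A) ∧ φ.Realize a ∧ ψ = φ.relabel a}

/-- `a` is an enumeration of the set `A` (without repetitions). -/
def IsEnumeration {V : Type} {l : ℕ} (a : Fin l → V) (A : Finset V) : Prop :=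
  Function.Injective a ∧ Set.range a = (A : Set V)

/-- The sets of size `k` on which `M` and `N` differ. -/
def diff {V : Type} (k : ℕ) (M N : L.Structure V) : Set (Finset V) :=
  {A | A.card = k ∧ ∃ a : Fin k → V, IsEnumeration a A ∧ qftp M a ≠ qftp N a}

/-- The distance of two finite structures with the same domain, in a language of maximum
arity `k`. -/
noncomputable def strDist {V : Type} (k : ℕ) (M N : L.Structure V) : ℝ :=
  ((diff k M N).ncard : ℝ) / ((Nat.card V).choose k : ℝ)

/-- A hereditary property: a nonempty class of finite structures that is closed under isomorphism
and under substructures. -/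
structure IsHereditaryProperty (H : Set (Bundled.{0} L.Structure)) : Prop where
  nonempty : H.Nonempty
  finite : ∀ M ∈ H, Finite M
  iso : ∀ M ∈ H, ∀ N : Bundled.{0} L.Structure, Nonempty (M ≃[L] N) → N ∈ H
  substructure : ∀ M ∈ H, ∀ S : L.Substructure M,
    (⟨S, inferInstance⟩ : Bundled.{0} L.Structure) ∈ H

/-- `H` has elements of arbitrarily large finite size. -/
def IsNontrivial (H : Set (Bundled.{0} L.Structure)) : Prop :=
  ∀ N : ℕ, ∃ n ≥ N, ∃ M ∈ H, Finite M ∧ Nat.card M = n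

end Types

/-! ## Templates, choice functions and subpatterns

Throughout, `k` stands for the maximum arity of `L`. -/

section Templates

variable {L : FirstOrder.Language.{0, 0}}

/-- The language with one `k`-ary relation symbol `R_p` for each `p` in `S_k(H)`. The type `p`
belonging to a relation symbol `R` is `R.1`. -/
def templateLanguage (k : ℕ) (H : Set (Bundled.{0} L.Structure)) : FirstOrder.Language.{0, 0} where
  Functions := fun _ => Empty
  Relations := fun n => {p : Set (L.Formula (Fin n)) // n = k ∧ p ∈ typeSpace n H}

variable {k : ℕ} {H : Set (Bundled.{0} L.Structure)} {V : Type}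

/-- `M ⊨ R_p(a)`. -/
def Holds (M : (templateLanguage k H).Structure V) (R : (templateLanguage k H).Relations k)
    (a : Fin k → V) : Prop :=
  M.RelMap R a

/-- Every `k`-subset of the domain has an enumeration on which some relation holds. -/
def IsComplete (M : (templateLanguage k H).Structure V) : Prop :=
  ∀ A : Finset V, A.card = k → ∃ a : Fin k → V, IsEnumeration a A ∧
    ∃ R : (templateLanguage k H).Relations k, Holds M R a

/-- Templates. In `compat`, `subst R'.1 μ` is the type `p'(x_{μ(1)}, …, x_{μ(k)})`. -/
structure IsTemplate (M : (templateLanguage k H).Structure V) : Prop where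
  complete : IsComplete M
  proper : ∀ (R : (templateLanguage k H).Relations k) (a : Fin k → V),
    ¬ Function.Injective a → ¬ Holds M R a
  compat : ∀ (R R' : (templateLanguage k H).Relations k) (μ : Equiv.Perm (Fin k)),
    R.1 = subst R'.1 μ →
      ∀ a : Fin k → V, Function.Injective a → (Holds M R a ↔ Holds M R' (a ∘ μ))

/-- The set of choices for `A` in `M`. -/
def choices (M : (templateLanguage k H).Structure V) (A : Finset V) : Set (Set (L.Formula V)) :=
  {q | ∃ (R : (templateLanguage k H).Relations k) (a : Fin k → V),
    IsEnumeration a A ∧ Holds M R a ∧ q = subst R.1 a}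

/-- `χ` is a choice function for `M`. -/
def IsChoice (M : (templateLanguage k H).Structure V)
    (χ : {A : Finset V // A.card = k} → Set (L.Formula V)) : Prop :=
  ∀ A, χ A ∈ choices M A.1

/-- `N` is the full subpattern chosen by `χ`. -/
def Chooses (χ : {A : Finset V // A.card = k} → Set (L.Formula V)) (N : L.Structure V) : Prop :=
  ∀ A, χ A = diag N A.1

/-- `N` is a full subpattern of `M`. -/
def IsFullSubpattern (N : L.Structure V) (M : (templateLanguage k H).Structure V) : Prop :=
  ∃ χ, IsChoice M χ ∧ Chooses χ N

/-- The number of full subpatterns of `M`. -/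
noncomputable def sub (M : (templateLanguage k H).Structure V) : ℕ :=
  Nat.card {N : L.Structure V // IsFullSubpattern N M}

/-- `M` is `H`-random: it is complete, and each of its choice functions chooses an element
of `H`. -/
def IsRandom (M : (templateLanguage k H).Structure V) : Prop :=
  IsComplete M ∧ ∀ χ, IsChoice M χ →
    ∃ N : L.Structure V, (⟨V, N⟩ : Bundled.{0} L.Structure) ∈ H ∧ Chooses χ N

variable (k H V)

/-- The set of `H`-random templates with domain `V`. -/
def randomTemplates : Set ((templateLanguage k H).Structure V) :=
  {M | IsTemplate M ∧ IsRandom M}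

/-- The maximum of `sub M` over all `H`-random templates of size `n`, where `max ∅ = 0`. -/
noncomputable def ex (n : ℕ) : ℕ :=
  sSup {s | ∃ (W : Type) (M : (templateLanguage k H).Structure W),
    Finite W ∧ Nat.card W = n ∧ M ∈ randomTemplates k H W ∧ s = sub M}

/-- The set of extremal `H`-random templates with (finite) domain `V`. -/
def extremalTemplates : Set ((templateLanguage k H).Structure V) :=
  {M | M ∈ randomTemplates k H V ∧ sub M = ex k H (Nat.card V)}

end Templates

/-- The nontrivial class `H` has a stability theorem. -/
def HasStabilityTheorem {L : FirstOrder.Language.{0, 0}} (H : Set (Bundled.{0} L.Structure)) : Prop :=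
  IsNontrivial H ∧
  ∀ δ : ℝ, 0 < δ → ∃ ε : ℝ, 0 < ε ∧ ∃ N : ℕ, ∀ n : ℕ, N < n →
    ∀ V : Type, Finite V → Nat.card V = n →
      ∀ M ∈ randomTemplates (maxArity L) H V,
        (ex (maxArity L) H n : ℝ) ^ (1 - ε) ≤ (sub M : ℝ) →
          ∃ M' ∈ extremalTemplates (maxArity L) H V, strDist (maxArity L) M M' ≤ δ

/-! ## Metric spaces with distances in `{1, …, r}` -/

section Metric

/-- The relation symbols `R_1, …, R_r`, all binary. -/
inductive DistRel (r : ℕ) : ℕ → Type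
  | rel (i : Set.Icc 1 r) : DistRel r 2

/-- The language with `r` binary relation symbols. -/
def metricLanguage (r : ℕ) : FirstOrder.Language.{0, 0} where
  Functions := fun _ => Empty
  Relations := DistRel r

theorem maxArity_metricLanguage (r : ℕ) (hr : 1 ≤ r) : maxArity (metricLanguage r) = 2 := by
  have h : {n | Nonempty ((metricLanguage r).Relations n)} = {2} := by
    ext n
    constructor
    · rintro ⟨h⟩
      cases h
      rfl
    · rintro rfl
      exact ⟨DistRel.rel ⟨1, le_refl 1, hr⟩⟩
  rw [maxArity, h]
  exact csSup_singleton 2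

/-- The symbol `R_i`. -/
def distSymb {r : ℕ} (i : Set.Icc 1 r) : (metricLanguage r).Relations 2 := DistRel.rel i

/-- The class of finite metric spaces with all distances (of distinct points) in `{1, …, r}`,
where `R_i(x, y)` says that the distance of `x` and `y` is `i`. -/
def metricClass (r : ℕ) : Set (Bundled.{0} (metricLanguage r).Structure) :=
  {M | Finite M ∧ ∃ _ : MetricSpace M,
    (∀ x y : M, x ≠ y → ∃ i : Set.Icc 1 r, dist x y = ((i : ℕ) : ℝ)) ∧
    ∀ (i : Set.Icc 1 r) (x y : M), M.str.RelMap (distSymb i) ![x, y] ↔ dist x y = ((i : ℕ) : ℝ)}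

/-- The atomic formula `R_i(x_s, x_t)`. -/
def distFormula {r : ℕ} (i : Set.Icc 1 r) (s t : Fin 2) : (metricLanguage r).Formula (Fin 2) :=
  (distSymb i).formula₂ (FirstOrder.Language.Term.var s) (FirstOrder.Language.Term.var t)

/-- The formulas which say that the distance of `x_0` and `x_1` is `i`. -/
def distFormulas {r : ℕ} (i : Set.Icc 1 r) : Set ((metricLanguage r).Formula (Fin 2)) :=
  {∼((FirstOrder.Language.Term.var 0).equal (FirstOrder.Language.Term.var 1))} ∪
  {distFormula i 0 1, distFormula i 1 0} ∪
  {φ | ∃ j : Set.Icc 1 r, j ≠ i ∧ (φ = ∼(distFormula j 0 1) ∨ φ = ∼(distFormula j 1 0))}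

/-- The set of distances that `M` allows between `x` and `y`: all `i` such that
`M ⊨ R_p(x, y) ∨ R_p(y, x)`, where `p` is the type saying that the distance is `i`. -/
def allowedDistances {r : ℕ} {V : Type}
    (M : (templateLanguage 2 (metricClass r)).Structure V) (x y : V) : Set ℕ :=
  {d | ∃ (i : Set.Icc 1 r) (R : (templateLanguage 2 (metricClass r)).Relations 2),
    (i : ℕ) = d ∧ distFormulas i ⊆ R.1 ∧ (Holds M R ![x, y] ∨ Holds M R ![y, x])}

end Metric

end HereditaryTemplates

/-! A template amounts to a set `allowed M A` of distances for each pair `A`. Choices on different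
pairs are independent, so `sub M` is the product of the sizes of these sets (`sub_eq_prod`).
Moreover, `M` is random exactly when the sets are nonempty and every selection of distances is a
metric (`isRandom_iff`). In particular, the three sets on a triangle must satisfy the triangle
inequality for all choices (`IsRandom.triangle`).

Let `a_i` and `b_i` be the extremes of the three sets on a triangle. Each `b_i` is at most `r` and
at most the sum of the other two minima, so the sizes add up to at most `3 + Σ b_i - Σ a_i ≤ 3 + Σ
b_i / 2 ≤ 3t` with `t = r / 2 + 1`. If all three sizes are `t`, all three sets are `{r/2, …, r}`
(`TriangleSets.ncard_le`). Otherwise AM-GM is strict, and integrality makes the product of the sizes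
at most `t ^ 3 - 1` (`log_add_log_add_log_le`).

Averaging over triangles (`sum_pairs_nonneg_of_triangles`) turns this into the central estimate
`log_sub_le`: `log (sub M)` is at most `C(n,2) log t` minus a positive constant times the number of
pairs where `M` differs from `upperTemplate`. This one inequality gives the value of `ex`, the
uniqueness of the extremal template and stability. -/

namespace HereditaryTemplates

/-! ## Quantifier-free types in relational languages -/

section Types

variable {L : FirstOrder.Language.{0, 0}}

/-- Types and diagrams are sets of syntactic formulas, so renamings must compose literally and not
just up to equivalence. Without quantifiers there are no bound variables, and the claim reduces to
terms. -/
theorem Formula.relabel_relabel_of_isQF {α β γ : Type} (f : α → β) (g : β → γ) {φ : L.Formula α}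
    (hφ : φ.IsQF) : (φ.relabel f).relabel g = φ.relabel (g ∘ f) := by
  have key (t : L.Term (α ⊕ Fin 0)) :
      (t.relabel (Language.BoundedFormula.relabelAux (Sum.inl ∘ f : α → β ⊕ Fin 0) 0)).relabel
        (Language.BoundedFormula.relabelAux (Sum.inl ∘ g : β → γ ⊕ Fin 0) 0) =
      t.relabel (Language.BoundedFormula.relabelAux (Sum.inl ∘ (g ∘ f) : α → γ ⊕ Fin 0) 0) := by
    rw [Language.Term.relabel_relabel]
    congr 1
    funext x
    rcases x with x | x
    · rfl
    · exact x.elim0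
  induction hφ with
  | falsum => rfl
  | of_isAtomic h =>
    cases h with
    | equal t₁ t₂ =>
      exact congrArg₂ Language.BoundedFormula.equal (key t₁) (key t₂)
    | rel R ts =>
      exact congrArg (Language.BoundedFormula.rel R) (funext fun i => key (ts i))
  | imp _ _ ih₁ ih₂ => exact congrArg₂ Language.BoundedFormula.imp ih₁ ih₂

theorem Formula.relabel_id_of_isQF {α : Type} {φ : L.Formula α} (hφ : φ.IsQF) :
    φ.relabel (id : α → α) = φ := by
  have key (t : L.Term (α ⊕ Fin 0)) :
      t.relabel (Language.BoundedFormula.relabelAux (Sum.inl ∘ id : α → α ⊕ Fin 0) 0) = t := by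
    refine Eq.trans (congrArg (fun f => Language.Term.relabel f t) ?_) t.relabel_id
    funext x
    rcases x with x | x
    · rfl
    · exact x.elim0
  induction hφ with
  | falsum => rfl
  | of_isAtomic h =>
    cases h with
    | equal t₁ t₂ =>
      exact congrArg₂ Language.BoundedFormula.equal (key t₁) (key t₂)
    | rel R ts =>
      exact congrArg (Language.BoundedFormula.rel R) (funext fun i => key (ts i))
  | imp _ _ ih₁ ih₂ => exact congrArg₂ Language.BoundedFormula.imp ih₁ ih₂

/-- In a relational language every term is a variable, so the atomic formulas only see the equality
pattern of the tuple and the relations on its subtuples, possibly with repetitions. -/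
theorem qftp_congr [L.IsRelational] {V W : Type} (M : L.Structure V) (N : L.Structure W) {l : ℕ}
    (a : Fin l → V) (b : Fin l → W) (heq : ∀ i j, a i = a j ↔ b i = b j)
    (hrel : ∀ (n : ℕ) (R : L.Relations n) (x : Fin n → Fin l),
      M.RelMap R (a ∘ x) ↔ N.RelMap R (b ∘ x)) : qftp M a = qftp N b := by
  have term (t : L.Term (Fin l ⊕ Fin 0)) : ∃ i : Fin l, t = Language.Term.var (Sum.inl i) := by
    cases t with
    | var x =>
      rcases x with x | x
      · exact ⟨x, rfl⟩
      · exact x.elim0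
    | func f _ => exact isEmptyElim f
  have key (φ : L.Formula (Fin l)) (hφ : φ.IsQF) : φ.Realize a ↔ φ.Realize b := by
    unfold Language.Formula.Realize
    induction hφ with
    | falsum => rfl
    | of_isAtomic h =>
      cases h with
      | equal t₁ t₂ =>
        obtain ⟨i, rfl⟩ := term t₁
        obtain ⟨j, rfl⟩ := term t₂
        exact heq i j
      | rel R ts =>
        choose x hx using fun i => term (ts i)
        obtain rfl : ts = fun i => Language.Term.var (Sum.inl (x i)) := funext hx
        exact hrel _ R x
    | imp _ _ ih₁ ih₂ => exact imp_congr ih₁ ih₂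
  ext φ
  exact and_congr_right (key φ)

/-- A tuple of any length from `A` factors through `a`, and renaming along the factorization gives a
formula in the variables of `a`. -/
theorem diag_eq_subst {V : Type} (N : L.Structure V) {l : ℕ} {a : Fin l → V} {A : Finset V}
    (ha : Set.range a = (A : Set V)) : diag N A = subst (qftp N a) a := by
  ext ψ
  constructor
  · rintro ⟨n, φ, b, hφ, hb, hr, rfl⟩
    have hb' (i : Fin n) : ∃ j, a j = b i := by
      have h : b i ∈ (A : Set V) := hb i
      rwa [← ha] at h
    choose g hg using hb'
    obtain rfl : a ∘ g = b := funext hg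
    refine ⟨φ.relabel g, ⟨hφ.relabel _, Language.Formula.realize_relabel.2 hr⟩, ?_⟩
    exact Formula.relabel_relabel_of_isQF g a hφ
  · rintro ⟨φ, ⟨hφ, hr⟩, rfl⟩
    refine ⟨l, φ, a, hφ, fun i => ?_, hr, rfl⟩
    have h : a i ∈ Set.range a := ⟨i, rfl⟩
    rwa [ha] at h

theorem relMap_iff_formula_mem_diag {V : Type} (M : L.Structure V) {A : Finset V} {n : ℕ}
    (R : L.Relations n) {a : Fin n → V} (ha : ∀ i, a i ∈ A) :
    M.RelMap R a ↔
      (R.formula (Language.Term.var : Fin n → L.Term (Fin n))).relabel a ∈ diag M A := by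
  constructor
  · intro hR
    exact ⟨n, _, a, Language.BoundedFormula.IsQF.of_isAtomic
      (Language.BoundedFormula.IsAtomic.rel _ _), ha, Language.Formula.realize_rel.2 hR, rfl⟩
  · rintro ⟨l, φ, b, -, -, hr, he⟩
    -- The witnesses `φ` and `b` may differ from the atomic formula and `a`, but both relabel to the
    -- same formula over `V`; evaluating that formula at the identity recovers the relation.
    have h1 : ((R.formula (Language.Term.var : Fin n → L.Term (Fin n))).relabel a).Realize
        (id : V → V) := by
      rw [he]
      exact Language.Formula.realize_relabel.2 hr
    exact Language.Formula.realize_rel.1 (Language.Formula.realize_relabel.1 h1)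

theorem relMap_iff_of_diag_eq {V : Type} {M N : L.Structure V} {A : Finset V}
    (h : diag M A = diag N A) {n : ℕ} (R : L.Relations n) {a : Fin n → V} (ha : ∀ i, a i ∈ A) :
    M.RelMap R a ↔ N.RelMap R a := by
  rw [relMap_iff_formula_mem_diag M R ha, relMap_iff_formula_mem_diag N R ha, h]

end Types

/-! ## Pairs and distance structures -/

section Pairs

variable {V : Type}

/-- The two-element set `{x, y}`. -/
def pair (x y : V) (h : x ≠ y) : {A : Finset V // A.card = 2} :=
  ⟨Finset.cons x {y} (by simpa using h), by simp⟩

theorem coe_pair {x y : V} (h : x ≠ y) : ((pair x y h).1 : Set V) = {x, y} := by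
  simp [pair]

theorem mem_pair {x y z : V} (h : x ≠ y) : z ∈ (pair x y h).1 ↔ z = x ∨ z = y := by
  simp [pair]

theorem pair_eq_iff {x y z w : V} (h : x ≠ y) (h' : z ≠ w) :
    pair x y h = pair z w h' ↔ x = z ∧ y = w ∨ x = w ∧ y = z := by
  rw [Subtype.ext_iff, ← Finset.coe_inj, coe_pair, coe_pair]
  exact Set.pair_eq_pair_iff

theorem pair_comm {x y : V} (h : x ≠ y) : pair y x h.symm = pair x y h :=
  (pair_eq_iff _ _).2 (Or.inr ⟨rfl, rfl⟩)

theorem exists_eq_pair (A : {A : Finset V // A.card = 2}) : ∃ x y, ∃ h : x ≠ y, A = pair x y h := by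
  classical
  obtain ⟨x, y, h, hA⟩ := Finset.card_eq_two.1 A.2
  refine ⟨x, y, h, Subtype.ext ?_⟩
  rw [← Finset.coe_inj, coe_pair, hA]
  simp

theorem isEnumeration_iff {a : Fin 2 → V} {A : {A : Finset V // A.card = 2}} :
    IsEnumeration a A.1 ↔ ∃ h : a 0 ≠ a 1, A = pair (a 0) (a 1) h := by
  have hr : Set.range a = {a 0, a 1} := by
    ext x
    simp [Fin.exists_fin_two, eq_comm]
  constructor
  · rintro ⟨hinj, h⟩
    have hne : a 0 ≠ a 1 := hinj.ne (by decide)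
    refine ⟨hne, Subtype.ext ?_⟩
    rw [← Finset.coe_inj, coe_pair, ← h, hr]
  · rintro ⟨hne, rfl⟩
    refine ⟨?_, by rw [coe_pair, hr]⟩
    intro i j hij
    fin_cases i <;> fin_cases j <;> simp_all

theorem isEnumeration_pair {x y : V} (h : x ≠ y) : IsEnumeration ![x, y] (pair x y h).1 :=
  isEnumeration_iff.2 ⟨h, rfl⟩

theorem exists_isEnumeration (A : {A : Finset V // A.card = 2}) :
    ∃ a : Fin 2 → V, IsEnumeration a A.1 := by
  obtain ⟨x, y, h, rfl⟩ := exists_eq_pair A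
  exact ⟨_, isEnumeration_pair h⟩

end Pairs

/-! ### Members of the class as distance functions on pairs. -/

section Metric

variable {r : ℕ} {V : Type}

instance : (metricLanguage r).IsRelational := fun _ => inferInstanceAs (IsEmpty Empty)

instance (k : ℕ) {L : FirstOrder.Language.{0, 0}} (H : Set (Bundled.{0} L.Structure)) :
    (templateLanguage k H).IsRelational := fun _ => inferInstanceAs (IsEmpty Empty)

/-- The structure in which distinct points `x`, `y` have distance `d {x, y}`. -/
@[reducible]
def distStructure (d : {A : Finset V // A.card = 2} → Set.Icc 1 r) :
    (metricLanguage r).Structure V where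
  funMap f := Empty.elim f
  RelMap R a := match R, a with
    | DistRel.rel i, a => ∃ h : a 0 ≠ a 1, d (pair (a 0) (a 1) h) = i

theorem distStructure_relMap (d : {A : Finset V // A.card = 2} → Set.Icc 1 r) (i : Set.Icc 1 r)
    (a : Fin 2 → V) :
    (distStructure d).RelMap (distSymb i) a ↔ ∃ h : a 0 ≠ a 1, d (pair (a 0) (a 1) h) = i :=
  Iff.rfl

theorem metricLanguage_forall {P : ∀ n, (metricLanguage r).Relations n → Prop}
    (h : ∀ i, P 2 (distSymb i)) (n : ℕ) (R : (metricLanguage r).Relations n) : P n R := by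
  cases R with
  | rel i => exact h i

theorem metricStructure_ext {M N : (metricLanguage r).Structure V}
    (h : ∀ (i : Set.Icc 1 r) (x y : V),
      M.RelMap (distSymb i) ![x, y] ↔ N.RelMap (distSymb i) ![x, y]) : M = N := by
  refine Language.Structure.ext (funext₃ fun n f _ => Empty.elim f) ?_
  funext n R a
  refine propext ?_
  revert a
  refine metricLanguage_forall (P := fun n R => ∀ a, M.RelMap R a ↔ N.RelMap R a) ?_ n R
  intro i a
  have ha : a = ![a 0, a 1] := by
    funext j
    fin_cases j <;> rfl
  rw [ha]
  exact h i _ _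

theorem distStructure_injective :
    Function.Injective (distStructure (r := r) (V := V)) := by
  intro d d' h
  funext A
  obtain ⟨x, y, hxy, rfl⟩ := exists_eq_pair A
  have h1 : (distStructure d).RelMap (distSymb (d (pair x y hxy))) ![x, y] := ⟨hxy, rfl⟩
  rw [h] at h1
  obtain ⟨_, h2⟩ := h1
  exact h2.symm

/-- The triangle inequality for a distance function on pairs. -/
def IsMetric (d : {A : Finset V // A.card = 2} → Set.Icc 1 r) : Prop :=
  ∀ (x y z : V) (hxy : x ≠ y) (hyz : y ≠ z) (hxz : x ≠ z),
    (d (pair x z hxz) : ℕ) ≤ d (pair x y hxy) + d (pair y z hyz)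

theorem distStructure_mem [Finite V] {d : {A : Finset V // A.card = 2} → Set.Icc 1 r}
    (hd : IsMetric d) :
    (⟨V, distStructure d⟩ : Bundled.{0} (metricLanguage r).Structure) ∈ metricClass r := by
  classical
  have hpos (A) : 1 ≤ (d A : ℕ) := (d A).2.1
  let f : V → V → ℝ := fun x y => if h : x = y then 0 else ((d (pair x y h) : ℕ) : ℝ)
  have f_ne {x y : V} (h : x ≠ y) : f x y = ((d (pair x y h) : ℕ) : ℝ) := dif_neg h
  have f_self (x : V) : f x x = 0 := dif_pos rfl
  have f_nonneg (x y : V) : 0 ≤ f x y := by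
    by_cases h : x = y
    · rw [h, f_self]
    · rw [f_ne h]; positivity
  have f_eq {x y : V} (h : f x y = 0) : x = y := by
    by_contra hne
    rw [f_ne hne] at h
    have := hpos (pair x y hne)
    have h' : (d (pair x y hne) : ℕ) = 0 := by exact_mod_cast h
    omega
  have f_comm (x y : V) : f x y = f y x := by
    by_cases h : x = y
    · rw [h]
    · rw [f_ne h, f_ne (Ne.symm h), pair_comm h]
  have f_tri (x y z : V) : f x z ≤ f x y + f y z := by
    by_cases hxz : x = z
    · rw [hxz, f_self]
      exact add_nonneg (f_nonneg _ _) (f_nonneg _ _)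
    by_cases hxy : x = y
    · rw [hxy, f_self, zero_add]
    by_cases hyz : y = z
    · rw [hyz, f_self, add_zero]
    rw [f_ne hxz, f_ne hxy, f_ne hyz]
    exact_mod_cast hd x y z hxy hyz hxz
  let ms : MetricSpace V :=
    { dist := f
      dist_self := f_self
      dist_comm := f_comm
      dist_triangle := f_tri
      eq_of_dist_eq_zero := f_eq }
  refine ⟨‹Finite V›, ms, fun x y h => ⟨_, f_ne h⟩, fun i x y => ?_⟩
  change (∃ h : x ≠ y, d (pair x y h) = i) ↔ f x y = _
  have hi := i.2.1
  constructor
  · rintro ⟨h, rfl⟩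
    exact f_ne h
  · intro h
    have hne : x ≠ y := by
      rintro rfl
      rw [f_self] at h
      have h' : (i : ℕ) = 0 := by exact_mod_cast h.symm
      omega
    refine ⟨hne, Subtype.ext ?_⟩
    rw [f_ne hne] at h
    exact_mod_cast h

theorem exists_eq_distStructure {M : (metricLanguage r).Structure V}
    (hM : (⟨V, M⟩ : Bundled.{0} (metricLanguage r).Structure) ∈ metricClass r) :
    ∃ d : {A : Finset V // A.card = 2} → Set.Icc 1 r, M = distStructure d ∧ IsMetric d := by
  obtain ⟨-, ms, hdist, hrel⟩ := hM
  change MetricSpace V at ms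
  replace hdist : ∀ x y : V, x ≠ y → ∃ i : Set.Icc 1 r, dist x y = ((i : ℕ) : ℝ) := hdist
  replace hrel : ∀ (i : Set.Icc 1 r) (x y : V),
    M.RelMap (distSymb i) ![x, y] ↔ dist x y = ((i : ℕ) : ℝ) := hrel
  have hA (A : {A : Finset V // A.card = 2}) : ∃ i : Set.Icc 1 r,
      ∀ (x y : V) (h : x ≠ y), A = pair x y h → dist x y = ((i : ℕ) : ℝ) := by
    obtain ⟨x, y, h, rfl⟩ := exists_eq_pair A
    obtain ⟨i, hi⟩ := hdist x y h
    refine ⟨i, fun z w h' he => ?_⟩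
    rcases (pair_eq_iff _ _).1 he with ⟨rfl, rfl⟩ | ⟨rfl, rfl⟩
    · exact hi
    · rw [dist_comm, hi]
  choose d hd using hA
  refine ⟨d, metricStructure_ext fun i x y => ?_, fun x y z hxy hyz hxz => ?_⟩
  · rw [hrel, distStructure_relMap]
    constructor
    · intro h
      have hne : x ≠ y := by
        rintro rfl
        rw [dist_self] at h
        have h' : (i : ℕ) = 0 := by exact_mod_cast h.symm
        have := i.2.1
        omega
      refine ⟨hne, Subtype.ext ?_⟩
      rw [hd _ x y hne rfl] at h
      exact_mod_cast h
    · rintro ⟨h, rfl⟩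
      exact hd _ x y h rfl
  · have h := dist_triangle x y z
    rw [hd _ x y hxy rfl, hd _ y z hyz rfl, hd _ x z hxz rfl] at h
    exact_mod_cast h

theorem distStructure_mem_iff [Finite V] {d : {A : Finset V // A.card = 2} → Set.Icc 1 r} :
    (⟨V, distStructure d⟩ : Bundled.{0} (metricLanguage r).Structure) ∈ metricClass r ↔
      IsMetric d := by
  refine ⟨fun h => ?_, distStructure_mem⟩
  obtain ⟨d', h, hd'⟩ := exists_eq_distStructure h
  rwa [distStructure_injective h]

theorem isHereditaryProperty_metricClass (r : ℕ) : IsHereditaryProperty (metricClass r) where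
  nonempty := by
    refine ⟨⟨Empty, { funMap := fun f => Empty.elim f, RelMap := fun _ _ => False }⟩,
      inferInstanceAs (Finite Empty), ?_⟩
    let ms : MetricSpace Empty :=
      { dist := fun x => x.elim
        dist_self := fun x => x.elim
        dist_comm := fun x => x.elim
        dist_triangle := fun x => x.elim
        eq_of_dist_eq_zero := fun {x} => x.elim }
    exact ⟨ms, fun x => x.elim, fun _ x => x.elim⟩
  finite := fun M hM => hM.1
  iso := by
    rintro M ⟨hfin, ms, hdist, hrel⟩ N ⟨e⟩
    refine ⟨Finite.of_equiv M e.toEquiv, MetricSpace.induced e.symm e.symm.injective ms,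
      fun x y h => hdist _ _ (e.symm.injective.ne h), fun i x y => ?_⟩
    refine Iff.trans ?_ (hrel i (e.symm x) (e.symm y))
    refine (e.symm.map_rel (distSymb i) ![x, y]).symm.trans (iff_of_eq ?_)
    refine congrArg _ ?_
    funext j
    fin_cases j <;> rfl
  substructure := by
    rintro M ⟨hfin, ms, hdist, hrel⟩ S
    refine ⟨inferInstanceAs (Finite S), MetricSpace.induced Subtype.val Subtype.val_injective ms,
      fun x y h => hdist _ _ (Subtype.val_injective.ne h), fun i x y => ?_⟩
    refine Iff.trans ?_ (hrel i x.1 y.1)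
    refine (S.subtype.map_rel (distSymb i) ![x, y]).symm.trans (iff_of_eq ?_)
    refine congrArg _ ?_
    funext j
    fin_cases j <;> rfl

theorem isNontrivial_metricClass (hr : 1 ≤ r) : IsNontrivial (metricClass r) := fun N =>
  ⟨N, le_rfl, ⟨Fin N, distStructure fun _ => ⟨1, le_rfl, hr⟩⟩,
    distStructure_mem fun _ _ _ _ _ _ => by simp, inferInstanceAs (Finite (Fin N)),
    Nat.card_fin N⟩

end Metric

/-! ## The types of the class and their templates -/

section MetricTemplates

variable {r : ℕ} {V : Type}

/-- The type saying that the distance is `i`. -/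
def distType (i : Set.Icc 1 r) : Set ((metricLanguage r).Formula (Fin 2)) :=
  qftp (distStructure (V := Fin 2) fun _ => i) id

/-- Two distinct entries of `a` exhaust the two-element set `A`, so the only distance that the type
can see is `d A`. -/
theorem qftp_distStructure (d : {A : Finset V // A.card = 2} → Set.Icc 1 r) {a : Fin 2 → V}
    {A : {A : Finset V // A.card = 2}} (ha : IsEnumeration a A.1) :
    qftp (distStructure d) a = distType (d A) := by
  refine qftp_congr _ _ _ _ (fun i j => ha.1.eq_iff) ?_
  refine metricLanguage_forall fun i x => ?_
  rw [distStructure_relMap, distStructure_relMap]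
  constructor
  · rintro ⟨h, rfl⟩
    refine ⟨fun he => h (congrArg a he), congrArg d ?_⟩
    refine Subtype.ext (Finset.eq_of_subset_of_card_le (fun z hz => ?_) ?_).symm
    · rw [← Finset.mem_coe, ← ha.2]
      rcases (mem_pair h).1 hz with rfl | rfl <;> exact ⟨_, rfl⟩
    · rw [A.2, (pair _ _ h).2]
  · rintro ⟨h, rfl⟩
    have h' : (a ∘ x) 0 ≠ (a ∘ x) 1 := fun he => h (ha.1 he)
    refine ⟨h', congrArg d ?_⟩
    refine Subtype.ext (Finset.eq_of_subset_of_card_le (fun z hz => ?_) ?_)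
    · rw [← Finset.mem_coe, ← ha.2]
      rcases (mem_pair h').1 hz with rfl | rfl <;> exact ⟨_, rfl⟩
    · rw [A.2, (pair _ _ h').2]

theorem formula_mem_distType {i j : Set.Icc 1 r} {s t : Fin 2} :
    distFormula j s t ∈ distType i ↔ s ≠ t ∧ i = j := by
  let _ := distStructure (V := Fin 2) fun _ => i
  have h : (distFormula j s t).IsQF :=
    Language.BoundedFormula.IsQF.of_isAtomic (Language.BoundedFormula.IsAtomic.rel _ _)
  refine (and_iff_right h).trans ?_
  refine Language.Formula.realize_rel₂.trans ?_
  refine (distStructure_relMap _ _ _).trans ?_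
  exact exists_prop

/-- Links the formulas used in `allowedDistances` with the types `distType`, and shows that
different distances give different types. -/
theorem distFormulas_subset_distType {i j : Set.Icc 1 r} :
    distFormulas i ⊆ distType j ↔ i = j := by
  constructor
  · intro h
    have h1 : distFormula i 0 1 ∈ distType j := h (by simp [distFormulas])
    exact (formula_mem_distType.1 h1).2.symm
  · rintro rfl φ hφ
    let _ := distStructure (V := Fin 2) fun _ => i
    have key (j : Set.Icc 1 r) (hj : j ≠ i) (s t : Fin 2) : ∼(distFormula j s t) ∈ distType i := by
      refine ⟨(Language.BoundedFormula.IsQF.of_isAtomic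
        (Language.BoundedFormula.IsAtomic.rel _ _)).not, ?_⟩
      refine Language.Formula.realize_not.2 fun h => hj ?_
      exact ((formula_mem_distType (s := s) (t := t)).1 ⟨Language.BoundedFormula.IsQF.of_isAtomic
        (Language.BoundedFormula.IsAtomic.rel _ _), h⟩).2.symm
    rcases hφ with (rfl | rfl | rfl) | ⟨j, hj, rfl | rfl⟩
    · refine ⟨(Language.BoundedFormula.IsQF.of_isAtomic
        (Language.BoundedFormula.IsAtomic.equal _ _)).not, ?_⟩
      refine Language.Formula.realize_not.2 fun h => ?_
      exact absurd (Language.Formula.realize_equal.1 h) (by simp)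
    · exact formula_mem_distType.2 ⟨by decide, rfl⟩
    · exact formula_mem_distType.2 ⟨by decide, rfl⟩
    · exact key j hj 0 1
    · exact key j hj 1 0

theorem distType_injective : Function.Injective (distType (r := r)) := fun _ _ h =>
  distFormulas_subset_distType.1 ((distFormulas_subset_distType.2 rfl).trans h.subset)

theorem distType_mem_typeSpace (i : Set.Icc 1 r) : distType i ∈ typeSpace 2 (metricClass r) :=
  ⟨⟨Fin 2, distStructure fun _ => i⟩, distStructure_mem fun _ _ _ _ _ _ => by simp, id,
    Function.injective_id, rfl⟩

theorem exists_eq_distType {p : Set ((metricLanguage r).Formula (Fin 2))}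
    (hp : p ∈ typeSpace 2 (metricClass r)) : ∃ i, p = distType i := by
  obtain ⟨⟨V, M⟩, hM, a, ha, rfl⟩ := hp
  change Fin 2 → V at a
  obtain ⟨d, rfl, -⟩ := exists_eq_distStructure hM
  have ha' : a 0 ≠ a 1 := ha.ne (by decide)
  exact ⟨_, qftp_distStructure d (isEnumeration_iff.2 ⟨ha', rfl⟩)⟩

theorem subst_distType (i : Set.Icc 1 r) {a : Fin 2 → V} {A : {A : Finset V // A.card = 2}}
    (ha : IsEnumeration a A.1) :
    subst (distType i) a = diag (distStructure fun _ => i) A.1 := by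
  rw [diag_eq_subst _ ha.2, qftp_distStructure _ ha]

theorem diag_distStructure (d : {A : Finset V // A.card = 2} → Set.Icc 1 r)
    (A : {A : Finset V // A.card = 2}) :
    diag (distStructure d) A.1 = diag (distStructure fun _ => d A) A.1 := by
  obtain ⟨a, ha⟩ := exists_isEnumeration A
  rw [diag_eq_subst _ ha.2, diag_eq_subst _ ha.2, qftp_distStructure _ ha,
    qftp_distStructure _ ha]

/-- Both sides are the diagram of `{0, 1}`, read off through the enumerations `μ` and `id`. Hence
the relations of a template are symmetric. -/
theorem subst_distType_perm (i : Set.Icc 1 r) (μ : Equiv.Perm (Fin 2)) :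
    subst (distType i) μ = distType i := by
  have hμ : IsEnumeration μ (pair (0 : Fin 2) 1 (by decide)).1 := by
    refine ⟨μ.injective, ?_⟩
    rw [coe_pair, μ.surjective.range_eq]
    ext j
    fin_cases j <;> simp
  have hid : IsEnumeration id (pair (0 : Fin 2) 1 (by decide)).1 := by
    refine ⟨Function.injective_id, ?_⟩
    rw [coe_pair, Function.surjective_id.range_eq]
    ext j
    fin_cases j <;> simp
  rw [subst_distType i hμ, ← subst_distType i hid]
  exact (Set.image_congr fun φ hφ => Formula.relabel_id_of_isQF hφ.1).trans (Set.image_id' _)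

/-- The relation symbol of the type saying that the distance is `i`. -/
def distTypeSymb (i : Set.Icc 1 r) : (templateLanguage 2 (metricClass r)).Relations 2 :=
  ⟨distType i, rfl, distType_mem_typeSpace i⟩

theorem exists_eq_distTypeSymb (R : (templateLanguage 2 (metricClass r)).Relations 2) :
    ∃ i, R = distTypeSymb i := by
  obtain ⟨i, hi⟩ := exists_eq_distType R.2.2
  exact ⟨i, Subtype.ext hi⟩

/-- The set of distances that `M` allows on the pair `A`. -/
def allowed (M : (templateLanguage 2 (metricClass r)).Structure V)
    (A : {A : Finset V // A.card = 2}) : Set (Set.Icc 1 r) :=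
  {i | ∃ a, IsEnumeration a A.1 ∧ Holds M (distTypeSymb i) a}

variable {M N : (templateLanguage 2 (metricClass r)).Structure V}

theorem isComplete_iff : IsComplete M ↔ ∀ A, (allowed M A).Nonempty := by
  constructor
  · rintro h ⟨A, hA⟩
    obtain ⟨a, ha, R, hR⟩ := h A hA
    obtain ⟨i, rfl⟩ := exists_eq_distTypeSymb R
    exact ⟨i, a, ha, hR⟩
  · intro h A hA
    obtain ⟨i, a, ha, hi⟩ := h ⟨A, hA⟩
    exact ⟨a, ha, _, hi⟩

theorem mem_choices_iff {A : {A : Finset V // A.card = 2}}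
    {q : Set ((metricLanguage r).Formula V)} :
    q ∈ choices M A.1 ↔ ∃ i ∈ allowed M A, q = diag (distStructure fun _ => i) A.1 := by
  constructor
  · rintro ⟨R, a, ha, hR, rfl⟩
    obtain ⟨i, rfl⟩ := exists_eq_distTypeSymb R
    exact ⟨i, ⟨a, ha, hR⟩, subst_distType i ha⟩
  · rintro ⟨i, ⟨a, ha, hi⟩, rfl⟩
    exact ⟨_, a, ha, hi, (subst_distType i ha).symm⟩

theorem isChoice_of_mem_allowed {d : {A : Finset V // A.card = 2} → Set.Icc 1 r}
    (hd : ∀ A, d A ∈ allowed M A) : IsChoice M fun A => diag (distStructure d) A.1 := fun A =>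
  mem_choices_iff.2 ⟨d A, hd A, diag_distStructure d A⟩

theorem IsChoice.exists_eq {χ : {A : Finset V // A.card = 2} → Set ((metricLanguage r).Formula V)}
    (h : IsChoice M χ) : ∃ d : {A : Finset V // A.card = 2} → Set.Icc 1 r,
      (∀ A, d A ∈ allowed M A) ∧ χ = fun A => diag (distStructure d) A.1 := by
  choose d hd h' using fun A => mem_choices_iff.1 (h A)
  exact ⟨d, hd, funext fun A => (h' A).trans (diag_distStructure d A).symm⟩

theorem Chooses.eq_distStructure [Nontrivial V] {N : (metricLanguage r).Structure V}
    {d : {A : Finset V // A.card = 2} → Set.Icc 1 r}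
    (h : Chooses (k := 2) (fun A => diag (distStructure d) A.1) N) : N = distStructure d := by
  refine metricStructure_ext fun i x y => ?_
  obtain ⟨A, hx, hy⟩ : ∃ A : {A : Finset V // A.card = 2}, x ∈ A.1 ∧ y ∈ A.1 := by
    by_cases hxy : x = y
    -- Choices only control two-element sets, so a second point is needed to control the relations
    -- on the diagonal.
    · obtain ⟨z, hz⟩ := exists_ne x
      exact ⟨pair x z hz.symm, (mem_pair _).2 (Or.inl rfl), (mem_pair _).2 (Or.inl hxy.symm)⟩
    · exact ⟨pair x y hxy, (mem_pair _).2 (Or.inl rfl), (mem_pair _).2 (Or.inr rfl)⟩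
  refine relMap_iff_of_diag_eq (h A).symm _ fun j => ?_
  fin_cases j
  · exact hx
  · exact hy

theorem isFullSubpattern_iff [Nontrivial V] {N : (metricLanguage r).Structure V} :
    IsFullSubpattern N M ↔ ∃ d : {A : Finset V // A.card = 2} → Set.Icc 1 r,
      (∀ A, d A ∈ allowed M A) ∧ distStructure d = N := by
  constructor
  · rintro ⟨χ, hχ, hN⟩
    obtain ⟨d, hd, rfl⟩ := hχ.exists_eq
    exact ⟨d, hd, hN.eq_distStructure.symm⟩
  · rintro ⟨d, hd, rfl⟩
    exact ⟨_, isChoice_of_mem_allowed hd, fun _ => rfl⟩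

theorem sub_eq_prod [Nontrivial V] [Fintype {A : Finset V // A.card = 2}] :
    sub M = ∏ A, (allowed M A).ncard := by
  have e : (∀ A, allowed M A) ≃ {N : (metricLanguage r).Structure V // IsFullSubpattern N M} := by
    refine Equiv.ofBijective
      (fun d => ⟨distStructure fun A => (d A).1, isFullSubpattern_iff.2 ⟨_, fun A => (d A).2, rfl⟩⟩)
      ⟨fun d d' h => ?_, ?_⟩
    · have h0 : distStructure (fun A => (d A).1) = distStructure fun A => (d' A).1 :=
        Subtype.ext_iff.1 h
      have h' := distStructure_injective h0
      exact funext fun A => Subtype.ext (congrFun h' A)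
    · rintro ⟨N, hN⟩
      obtain ⟨d, hd, rfl⟩ := isFullSubpattern_iff.1 hN
      exact ⟨fun A => ⟨d A, hd A⟩, rfl⟩
  rw [sub, ← Nat.card_congr e, Nat.card_pi]
  rfl

theorem isRandom_iff [Nontrivial V] [Finite V] :
    IsRandom M ↔ (∀ A, (allowed M A).Nonempty) ∧
      ∀ d : {A : Finset V // A.card = 2} → Set.Icc 1 r, (∀ A, d A ∈ allowed M A) → IsMetric d := by
  rw [IsRandom, isComplete_iff]
  refine and_congr_right fun _ => ⟨fun h d hd => ?_, fun h χ hχ => ?_⟩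
  · obtain ⟨N, hN, hc⟩ := h _ (isChoice_of_mem_allowed hd)
    rw [hc.eq_distStructure] at hN
    exact distStructure_mem_iff.1 hN
  · obtain ⟨d, hd, rfl⟩ := hχ.exists_eq
    exact ⟨_, distStructure_mem (h d hd), fun _ => rfl⟩

/-- The three sides are different pairs, so any selection of distances can be overwritten on them by
`i`, `j`, `k` independently and must still be a metric. -/
theorem IsRandom.triangle [Nontrivial V] [Finite V] (h : IsRandom M) {x y z : V} (hxy : x ≠ y)
    (hyz : y ≠ z) (hxz : x ≠ z) {i j k : Set.Icc 1 r} (hi : i ∈ allowed M (pair x z hxz))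
    (hj : j ∈ allowed M (pair x y hxy)) (hk : k ∈ allowed M (pair y z hyz)) :
    (i : ℕ) ≤ j + k := by
  classical
  obtain ⟨hne, hmet⟩ := isRandom_iff.1 h
  choose d hd using hne
  have h1 : pair x y hxy ≠ pair x z hxz := by simp [pair_eq_iff, hyz, hxz]
  have h2 : pair y z hyz ≠ pair x z hxz := by simp [pair_eq_iff, hxy.symm, hyz]
  have h3 : pair x y hxy ≠ pair y z hyz := by simp [pair_eq_iff, hxy, hxz]
  let e := Function.update (Function.update (Function.update d (pair x z hxz) i)
    (pair x y hxy) j) (pair y z hyz) k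
  have he1 : e (pair x z hxz) = i := by simp [e, h1.symm, h2.symm]
  have he2 : e (pair x y hxy) = j := by simp [e, h3]
  have he3 : e (pair y z hyz) = k := by simp [e]
  have he : IsMetric e := by
    refine hmet e fun A => ?_
    by_cases hA1 : A = pair y z hyz
    · rw [hA1, he3]; exact hk
    by_cases hA2 : A = pair x y hxy
    · rw [hA2, he2]; exact hj
    by_cases hA3 : A = pair x z hxz
    · rw [hA3, he1]; exact hi
    · simpa [e, hA1, hA2, hA3] using hd A
  have := he x y z hxy hyz hxz
  rwa [he1, he2, he3] at this

theorem IsTemplate.holds_iff (h : IsTemplate M) {i : Set.Icc 1 r} {a : Fin 2 → V}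
    {A : {A : Finset V // A.card = 2}} (ha : IsEnumeration a A.1) :
    Holds M (distTypeSymb i) a ↔ i ∈ allowed M A := by
  refine ⟨fun hi => ⟨a, ha, hi⟩, ?_⟩
  rintro ⟨b, hb, hi⟩
  obtain ⟨μ, rfl⟩ : ∃ μ : Equiv.Perm (Fin 2), b = a ∘ μ := by
    have hba (j : Fin 2) : ∃ l, a l = b j := by
      have h : b j ∈ Set.range b := ⟨j, rfl⟩
      rwa [hb.2, ← ha.2] at h
    choose g hg using hba
    have hinj : Function.Injective g := fun j l hjl => hb.1 (by rw [← hg, hjl, hg])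
    exact ⟨Equiv.ofBijective g (Finite.injective_iff_bijective.1 hinj),
      funext fun j => (hg j).symm⟩
  exact (h.compat (distTypeSymb i) (distTypeSymb i) μ (subst_distType_perm i μ).symm a ha.1).2 hi

/-- The hypothesis concerns only the pair enumerated by `a`, so that the lemma also serves to
compare templates locally, on a single pair. -/
theorem IsTemplate.relMap_iff (hM : IsTemplate M) (hN : IsTemplate N) {n : ℕ}
    (R : (templateLanguage 2 (metricClass r)).Relations n) (a : Fin n → V)
    (h : ∀ A : {A : Finset V // A.card = 2}, Set.range a = (A.1 : Set V) → allowed M A = allowed N A) :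
    M.RelMap R a ↔ N.RelMap R a := by
  obtain ⟨p, rfl, hp⟩ := R
  obtain ⟨i, rfl⟩ := exists_eq_distType hp
  change Holds M (distTypeSymb i) a ↔ Holds N (distTypeSymb i) a
  by_cases ha : Function.Injective a
  · have hA : IsEnumeration a (pair (a 0) (a 1) (ha.ne (by decide))).1 :=
      isEnumeration_iff.2 ⟨_, rfl⟩
    rw [hM.holds_iff hA, hN.holds_iff hA, h _ hA.2]
  · exact iff_of_false (hM.proper _ _ ha) (hN.proper _ _ ha)

theorem IsTemplate.ext (hM : IsTemplate M) (hN : IsTemplate N)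
    (h : ∀ A, allowed M A = allowed N A) : M = N := by
  refine Language.Structure.ext (funext₃ fun n f _ => Empty.elim f) ?_
  funext n R a
  exact propext (hM.relMap_iff hN R a fun A _ => h A)

theorem IsTemplate.allowed_ne_of_mem_diff (hM : IsTemplate M) (hN : IsTemplate N) {A : Finset V}
    (hA : A ∈ diff 2 M N) : ∃ h : A.card = 2, allowed M ⟨A, h⟩ ≠ allowed N ⟨A, h⟩ := by
  obtain ⟨hcard, a, ha, hne⟩ := hA
  refine ⟨hcard, fun h => hne (qftp_congr _ _ _ _ (fun _ _ => Iff.rfl) fun n R x => ?_)⟩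
  refine hM.relMap_iff hN R (a ∘ x) fun B hB => ?_
  obtain rfl : B.1 = A := by
    refine Finset.eq_of_subset_of_card_le (Finset.coe_subset.1 ?_) (hcard.trans B.2.symm).le
    rw [← hB, ← ha.2]
    exact Set.range_comp_subset_range x a
  exact h

end MetricTemplates

/-! ## The extremal template -/

section Canonical

variable (r : ℕ) (V : Type)

/-- The template that allows the distances `r / 2, …, r` on every pair. -/
@[reducible]
def upperTemplate : (templateLanguage 2 (metricClass r)).Structure V where
  funMap f := Empty.elim f
  -- The arity is still a variable here, so the type is recognized by an atomic formula in it
  -- instead of by an equation with some `distType i`.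
  RelMap R a := Function.Injective a ∧ ∃ i : Set.Icc 1 r, r / 2 ≤ (i : ℕ) ∧ ∃ u v, u ≠ v ∧
    (distSymb i).formula₂ (Language.Term.var u) (Language.Term.var v) ∈ R.1

/-- The distances `r / 2, …, r`. -/
def upperHalf : Set (Set.Icc 1 r) := {i | r / 2 ≤ (i : ℕ)}

variable {r V}

theorem holds_upperTemplate {i : Set.Icc 1 r} {a : Fin 2 → V} :
    Holds (upperTemplate r V) (distTypeSymb i) a ↔ Function.Injective a ∧ i ∈ upperHalf r := by
  refine and_congr_right fun _ => ⟨?_, fun hi => ⟨i, hi, 0, 1, by decide, ?_⟩⟩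
  · rintro ⟨j, hj, u, v, -, h⟩
    rw [(formula_mem_distType.1 h).2]
    exact hj
  · exact formula_mem_distType.2 ⟨by decide, rfl⟩

theorem allowed_upperTemplate (A : {A : Finset V // A.card = 2}) :
    allowed (upperTemplate r V) A = upperHalf r := by
  ext i
  constructor
  · rintro ⟨a, -, h⟩
    exact (holds_upperTemplate.1 h).2
  · intro h
    obtain ⟨a, ha⟩ := exists_isEnumeration A
    exact ⟨a, ha, holds_upperTemplate.2 ⟨ha.1, h⟩⟩

theorem isRandom_upperTemplate [Finite V] [Nontrivial V] (hr : 1 ≤ r) (hr' : Even r) :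
    IsRandom (upperTemplate r V) := by
  refine isRandom_iff.2 ⟨fun A => ⟨⟨r, hr, le_rfl⟩, ?_⟩, fun d hd x y z hxy hyz hxz => ?_⟩
  · rw [allowed_upperTemplate]
    exact Nat.div_le_self _ _
  · have h1 := hd (pair x y hxy)
    have h2 := hd (pair y z hyz)
    rw [allowed_upperTemplate] at h1 h2
    have h1' : r / 2 ≤ (d (pair x y hxy) : ℕ) := h1
    have h2' : r / 2 ≤ (d (pair y z hyz) : ℕ) := h2
    have h3 := (d (pair x z hxz)).2.2
    -- Evenness enters here: two sides of length at least `r / 2` add up to at least `r`, the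
    -- largest possible third side.
    obtain ⟨m, rfl⟩ := hr'
    omega

theorem isTemplate_upperTemplate (hr : 1 ≤ r) : IsTemplate (upperTemplate r V) where
  complete := isComplete_iff.2 fun A => ⟨⟨r, hr, le_rfl⟩, by
    rw [allowed_upperTemplate]
    exact Nat.div_le_self _ _⟩
  proper := fun _ _ ha h => ha h.1
  compat := by
    intro R R' μ h a ha
    obtain ⟨i, rfl⟩ := exists_eq_distTypeSymb R
    obtain ⟨j, rfl⟩ := exists_eq_distTypeSymb R'
    obtain rfl : i = j := distType_injective (h.trans (subst_distType_perm j μ))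
    rw [holds_upperTemplate, holds_upperTemplate]
    exact and_congr_left fun _ => iff_of_true ha (ha.comp μ.injective)

theorem upperTemplate_mem_randomTemplates [Finite V] [Nontrivial V] (hr : 1 ≤ r) (hr' : Even r) :
    upperTemplate r V ∈ randomTemplates 2 (metricClass r) V :=
  ⟨isTemplate_upperTemplate hr, isRandom_upperTemplate hr hr'⟩

theorem allowedDistances_eq {M : (templateLanguage 2 (metricClass r)).Structure V}
    (hM : IsTemplate M) {x y : V} (h : x ≠ y) :
    allowedDistances M x y = (fun i : Set.Icc 1 r => (i : ℕ)) '' allowed M (pair x y h) := by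
  ext n
  constructor
  · rintro ⟨i, R, rfl, hi, hR⟩
    obtain ⟨j, rfl⟩ := exists_eq_distTypeSymb R
    obtain rfl : i = j := distFormulas_subset_distType.1 hi
    refine ⟨i, ?_, rfl⟩
    rcases hR with hR | hR
    · exact ⟨_, isEnumeration_pair h, hR⟩
    · exact ⟨_, pair_comm h ▸ isEnumeration_pair h.symm, hR⟩
  · rintro ⟨i, hi, rfl⟩
    exact ⟨i, distTypeSymb i, rfl, distFormulas_subset_distType.2 rfl,
      Or.inl ((hM.holds_iff (isEnumeration_pair h)).2 hi)⟩

theorem coe_image_upperHalf (hr : 2 ≤ r) :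
    (fun i : Set.Icc 1 r => (i : ℕ)) '' upperHalf r = Set.Icc (r / 2) r := by
  ext n
  constructor
  · rintro ⟨i, hi, rfl⟩
    exact ⟨hi, i.2.2⟩
  · rintro ⟨h1, h2⟩
    exact ⟨⟨n, by omega, h2⟩, h1, rfl⟩

theorem ncard_upperHalf (hr : 2 ≤ r) (hr' : Even r) : (upperHalf r).ncard = r / 2 + 1 := by
  rw [← Set.ncard_image_of_injective _ Subtype.val_injective, coe_image_upperHalf hr,
    ← Finset.coe_Icc, Set.ncard_coe_finset, Nat.card_Icc]
  obtain ⟨m, rfl⟩ := hr'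
  omega

end Canonical

/-! ## Triangles of sets of distances -/

section Triangles

variable {r : ℕ}

theorem exists_bounds {S : Set (Set.Icc 1 r)} (hS : S.Nonempty) :
    ∃ a ∈ S, ∃ b ∈ S, (a : ℕ) ≤ b ∧ S.ncard + a ≤ b + 1 ∧ S ⊆ Set.Icc a b ∧
      (S.ncard + a = b + 1 → S = Set.Icc a b) := by
  obtain ⟨a, ha, ha'⟩ := Set.exists_min_image S id S.toFinite hS
  obtain ⟨b, hb, hb'⟩ := Set.exists_max_image S id S.toFinite hS
  have hab : (a : ℕ) ≤ b := ha' b hb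
  have hsub : S ⊆ Set.Icc a b := fun x hx => ⟨ha' x hx, hb' x hx⟩
  have hcard : (Set.Icc a b).ncard + a = b + 1 := by
    have h : (Subtype.val '' Set.Icc a b : Set ℕ) = Finset.Icc (a : ℕ) b := by
      ext n
      simp only [Set.mem_image, Finset.coe_Icc]
      constructor
      · rintro ⟨i, hi, rfl⟩
        exact hi
      · rintro ⟨h1, h2⟩
        exact ⟨⟨n, a.2.1.trans h1, h2.trans b.2.2⟩, ⟨h1, h2⟩, rfl⟩
    rw [← Set.ncard_image_of_injective _ Subtype.val_injective, h, Set.ncard_coe_finset,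
      Nat.card_Icc]
    omega
  have hle := Set.ncard_le_ncard hsub (Set.toFinite _)
  exact ⟨a, ha, b, hb, hab, by omega, hsub, fun h =>
    Set.eq_of_subset_of_ncard_le hsub (by omega) (Set.toFinite _)⟩

/-- Every choice of distances from `S₁`, `S₂`, `S₃` satisfies the triangle inequality. -/
def TriangleSets (S₁ S₂ S₃ : Set (Set.Icc 1 r)) : Prop :=
  ∀ i ∈ S₁, ∀ j ∈ S₂, ∀ k ∈ S₃, (i : ℕ) ≤ j + k ∧ (j : ℕ) ≤ i + k ∧ (k : ℕ) ≤ i + j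

/-- Only the inequalities bounding each maximum by the two other minima matter. Adding them gives `Σ
b_i ≤ 2 Σ a_i`, hence `Σ (b_i - a_i) ≤ Σ b_i / 2 ≤ 3r / 2`. If all sizes are `r / 2 + 1`, equality
forces `b_i = r` and `a_i = r / 2`, and each set fills its interval. -/
theorem TriangleSets.ncard_le {S₁ S₂ S₃ : Set (Set.Icc 1 r)} (h : TriangleSets S₁ S₂ S₃)
    (h₁ : S₁.Nonempty) (h₂ : S₂.Nonempty) (h₃ : S₃.Nonempty) (hr : Even r) :
    S₁.ncard + S₂.ncard + S₃.ncard ≤ 3 * (r / 2 + 1) ∧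
      (S₁.ncard = r / 2 + 1 → S₂.ncard = r / 2 + 1 → S₃.ncard = r / 2 + 1 →
        S₁ = upperHalf r ∧ S₂ = upperHalf r ∧ S₃ = upperHalf r) := by
  obtain ⟨a₁, ha₁, b₁, hb₁, hab₁, hc₁, hs₁, he₁⟩ := exists_bounds h₁
  obtain ⟨a₂, ha₂, b₂, hb₂, hab₂, hc₂, hs₂, he₂⟩ := exists_bounds h₂
  obtain ⟨a₃, ha₃, b₃, hb₃, hab₃, hc₃, hs₃, he₃⟩ := exists_bounds h₃
  have t₁ := (h b₁ hb₁ a₂ ha₂ a₃ ha₃).1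
  have t₂ := (h a₁ ha₁ b₂ hb₂ a₃ ha₃).2.1
  have t₃ := (h a₁ ha₁ a₂ ha₂ b₃ hb₃).2.2
  have l₁ := b₁.2.2
  have l₂ := b₂.2.2
  have l₃ := b₃.2.2
  have key {a b : Set.Icc 1 r} (ha : (a : ℕ) = r / 2) (hb : (b : ℕ) = r) :
      Set.Icc a b = upperHalf r := by
    ext i
    refine ⟨fun hi => ha.symm.le.trans hi.1, fun hi => ⟨ha.le.trans hi, ?_⟩⟩
    exact i.2.2.trans hb.symm.le
  obtain ⟨m, rfl⟩ := hr
  refine ⟨by omega, fun n₁ n₂ n₃ => ⟨?_, ?_, ?_⟩⟩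
  · rw [he₁ (by omega), key] <;> omega
  · rw [he₂ (by omega), key] <;> omega
  · rw [he₃ (by omega), key] <;> omega

/-- A third of the gap between `log (t ^ 3)` and `log (t ^ 3 - 1)`. -/
noncomputable def logGap (t : ℕ) : ℝ := (3 * Real.log t - Real.log ((t : ℝ) ^ 3 - 1)) / 3

theorem logGap_pos {t : ℕ} (ht : 2 ≤ t) : 0 < logGap t := by
  have h2 : (2 : ℝ) ≤ t := by exact_mod_cast ht
  have h8 : (2 : ℝ) ^ 3 ≤ (t : ℝ) ^ 3 := by gcongr
  have h := Real.log_lt_log (x := (t : ℝ) ^ 3 - 1) (y := (t : ℝ) ^ 3) (by linarith) (by linarith)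
  rw [Real.log_pow] at h
  push_cast at h
  unfold logGap
  linarith

/-- AM-GM in the form `log u ≤ u - 1` with `u = x / t`, strict unless `x = t`, gives `a * b * c < t
^ 3`. As these are integers, the product is at most `t ^ 3 - 1`, which makes the gap uniform. -/
theorem log_add_log_add_log_le {t a b c : ℕ} (ht : 2 ≤ t) (ha : 1 ≤ a) (hb : 1 ≤ b) (hc : 1 ≤ c)
    (hsum : a + b + c ≤ 3 * t) (hne : ¬(a = t ∧ b = t ∧ c = t)) :
    Real.log a + Real.log b + Real.log c ≤ 3 * Real.log t - 3 * logGap t := by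
  have ht0 : (0 : ℝ) < t := by exact_mod_cast (by omega : 0 < t)
  have le {x : ℕ} (hx : 1 ≤ x) : Real.log x ≤ Real.log t + (x / t - 1) := by
    have hx0 : (0 : ℝ) < x := by exact_mod_cast hx
    have := Real.log_le_sub_one_of_pos (div_pos hx0 ht0)
    rw [Real.log_div hx0.ne' ht0.ne'] at this
    linarith
  have lt {x : ℕ} (hx : 1 ≤ x) (hxt : x ≠ t) : Real.log x < Real.log t + (x / t - 1) := by
    have hx0 : (0 : ℝ) < x := by exact_mod_cast hx
    have hne : (x : ℝ) / t ≠ 1 := by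
      rw [Ne, div_eq_one_iff_eq ht0.ne']
      exact_mod_cast hxt
    have := Real.log_lt_sub_one_of_pos (div_pos hx0 ht0) hne
    rw [Real.log_div hx0.ne' ht0.ne'] at this
    linarith
  have hs : (a : ℝ) / t + b / t + c / t ≤ 3 := by
    rw [← add_div, ← add_div, div_le_iff₀ ht0]
    exact_mod_cast hsum
  have hlt : Real.log a + Real.log b + Real.log c < 3 * Real.log t := by
    by_cases h1 : a = t
    · by_cases h2 : b = t
      · have h3 : c ≠ t := fun h3 => hne ⟨h1, h2, h3⟩
        linarith [le ha, le hb, lt hc h3]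
      · linarith [le ha, lt hb h2, le hc]
    · linarith [lt ha h1, le hb, le hc]
  have ha0 : (a : ℝ) ≠ 0 := by exact_mod_cast (by omega : a ≠ 0)
  have hb0 : (b : ℝ) ≠ 0 := by exact_mod_cast (by omega : b ≠ 0)
  have hc0 : (c : ℝ) ≠ 0 := by exact_mod_cast (by omega : c ≠ 0)
  have hpos : (0 : ℝ) < a * b * c := by positivity
  have hlog : Real.log (a * b * c) = Real.log a + Real.log b + Real.log c := by
    rw [Real.log_mul (mul_ne_zero ha0 hb0) hc0, Real.log_mul ha0 hb0]
  have hprod : (a : ℝ) * b * c < (t : ℝ) ^ 3 := by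
    rw [← Real.log_lt_log_iff hpos (by positivity), hlog, Real.log_pow]
    exact_mod_cast hlt
  have hprod' : (a : ℝ) * b * c ≤ (t : ℝ) ^ 3 - 1 := by
    have h : a * b * c < t ^ 3 := by exact_mod_cast hprod
    have h' : a * b * c + 1 ≤ t ^ 3 := h
    have h'' : (a : ℝ) * b * c + 1 ≤ (t : ℝ) ^ 3 := by exact_mod_cast h'
    linarith
  have := Real.log_le_log hpos hprod'
  rw [hlog] at this
  unfold logGap
  linarith

end Triangles

/-! ## Averaging over triangles -/

section Averaging

variable {V : Type} [Fintype V]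

/-- Let `S` be the double sum and `n` the number of points. Summing `f x y + f y z + f x z` over all
ordered triples gives `3nS`, of which the degenerate triples contribute `6S`. So `(3n - 6) S ≥ 0`,
and `n ≥ 3` suffices. -/
theorem sum_nonneg_of_triangles {f : V → V → ℝ} (hself : ∀ x, f x x = 0)
    (hcomm : ∀ x y, f x y = f y x) (hcard : 3 ≤ Fintype.card V)
    (htri : ∀ x y z, x ≠ y → y ≠ z → x ≠ z → 0 ≤ f x y + f y z + f x z) :
    0 ≤ ∑ x, ∑ y, f x y := by
  classical
  -- The left side equals the right side on degenerate triples and vanishes on triples of distinct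
  -- points.
  have key (x y z : V) : (if x = y then 2 * f x z else 0) + (if y = z then 2 * f x y else 0) +
      (if x = z then 2 * f x y else 0) ≤ f x y + f y z + f x z := by
    by_cases hxy : x = y
    · subst hxy
      by_cases hxz : x = z
      · subst hxz
        simp [hself]
      · simp [hxz, hself]
        linarith
    · by_cases hyz : y = z
      · subst hyz
        simp [hxy, hself]
        linarith
      · by_cases hxz : x = z
        · subst hxz
          simp [hxy, hself, hcomm y x, Ne.symm hxy]
          linarith
        · simpa [hxy, hyz, hxz] using htri x y z hxy hyz hxz
  have hsum := Finset.sum_le_sum fun x (_ : x ∈ Finset.univ) =>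
    Finset.sum_le_sum fun y (_ : y ∈ Finset.univ) =>
      Finset.sum_le_sum fun z (_ : z ∈ Finset.univ) => key x y z
  have e1 : ∑ x, ∑ y, ∑ z, (if x = y then 2 * f x z else 0) = 2 * ∑ x, ∑ y, f x y := by
    simp_rw [Finset.mul_sum]
    refine Finset.sum_congr rfl fun x _ => ?_
    rw [Finset.sum_comm]
    simp
  have e2 : ∑ x, ∑ y, ∑ z, (if y = z then 2 * f x y else 0) = 2 * ∑ x, ∑ y, f x y := by
    simp [Finset.mul_sum]
  have e3 : ∑ x, ∑ y, ∑ z, (if x = z then 2 * f x y else 0) = 2 * ∑ x, ∑ y, f x y := by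
    simp [Finset.mul_sum]
  have e4 : ∑ x, ∑ y, ∑ _z : V, f x y = Fintype.card V * ∑ x, ∑ y, f x y := by
    simp [Finset.mul_sum]
  have e5 : ∑ _x : V, ∑ y, ∑ z, f y z = Fintype.card V * ∑ x, ∑ y, f x y := by
    simp
  have e6 : ∑ x, ∑ _y : V, ∑ z, f x z = Fintype.card V * ∑ x, ∑ y, f x y := by
    simp [Finset.mul_sum]
  simp only [Finset.sum_add_distrib] at hsum
  rw [e1, e2, e3, e4, e5, e6] at hsum
  have hn : (3 : ℝ) ≤ Fintype.card V := by exact_mod_cast hcard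
  by_contra hneg
  nlinarith

theorem sum_pairs_nonneg_of_triangles [Fintype {A : Finset V // A.card = 2}]
    (w : {A : Finset V // A.card = 2} → ℝ) (hcard : 3 ≤ Fintype.card V)
    (htri : ∀ x y z (hxy : x ≠ y) (hyz : y ≠ z) (hxz : x ≠ z),
      0 ≤ w (pair x y hxy) + w (pair y z hyz) + w (pair x z hxz)) :
    0 ≤ ∑ A, w A := by
  classical
  let f : V → V → ℝ := fun x y => if h : x = y then 0 else w (pair x y h)
  have f_ne {x y : V} (h : x ≠ y) : f x y = w (pair x y h) := dif_neg h
  have f_self (x : V) : f x x = 0 := dif_pos rfl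
  have f_comm (x y : V) : f x y = f y x := by
    by_cases h : x = y
    · rw [h]
    · rw [f_ne h, f_ne (Ne.symm h), pair_comm h]
  have hpos : 0 ≤ ∑ x, ∑ y, f x y := by
    refine sum_nonneg_of_triangles f_self f_comm hcard fun x y z hxy hyz hxz => ?_
    rw [f_ne hxy, f_ne hyz, f_ne hxz]
    exact htri x y z hxy hyz hxz
  have hsum : ∑ x, ∑ y, f x y = ∑ A, 2 * w A := by
    have h1 (x y : V) : f x y = ∑ A, if ∃ h : x ≠ y, A = pair x y h then w A else 0 := by
      by_cases h : x = y
      · subst h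
        simp [f_self]
      · simp [f_ne h, h]
    simp_rw [h1]
    rw [← Finset.sum_product', Finset.sum_comm]
    refine Finset.sum_congr rfl fun A _ => ?_
    -- The factor 2 counts the two orderings of each pair.
    rw [← Finset.sum_filter, Finset.sum_const, nsmul_eq_mul]
    congr 1
    obtain ⟨x, y, h, rfl⟩ := exists_eq_pair A
    have h2 : (Finset.univ ×ˢ Finset.univ : Finset (V × V)).filter
        (fun p => ∃ h' : p.1 ≠ p.2, pair x y h = pair p.1 p.2 h') = {(x, y), (y, x)} := by
      ext ⟨u, v⟩
      simp only [Finset.mem_filter, Finset.mem_product, Finset.mem_univ, true_and,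
        Finset.mem_insert, Finset.mem_singleton, Prod.mk.injEq]
      constructor
      · rintro ⟨h', he⟩
        rcases (pair_eq_iff _ _).1 he with ⟨rfl, rfl⟩ | ⟨rfl, rfl⟩
        · exact Or.inl ⟨rfl, rfl⟩
        · exact Or.inr ⟨rfl, rfl⟩
      · rintro (⟨rfl, rfl⟩ | ⟨rfl, rfl⟩)
        · exact ⟨h, rfl⟩
        · exact ⟨h.symm, (pair_comm h).symm⟩
    rw [h2, Finset.card_pair (by simp [h])]
    norm_num
  rw [hsum, ← Finset.mul_sum] at hpos
  linarith

end Averaging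

/-! ## Extremality and stability -/

section Extremal

variable {r : ℕ} {V : Type} [Finite V]

/-- The pairs on which `M` differs from the extremal template. -/
def badPairs (M : (templateLanguage 2 (metricClass r)).Structure V) :
    Set {A : Finset V // A.card = 2} :=
  {A | allowed M A ≠ upperHalf r}

theorem card_pairs : Nat.card {A : Finset V // A.card = 2} = (Nat.card V).choose 2 := by
  classical
  have := Fintype.ofFinite V
  rw [Nat.card_eq_fintype_card, Nat.card_eq_fintype_card, Fintype.card_finset_len]

theorem nontrivial_of_three_le_card (hV : 3 ≤ Nat.card V) : Nontrivial V :=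
  Finite.one_lt_card_iff_nontrivial.1 (by omega)

theorem sub_upperTemplate (hV : 3 ≤ Nat.card V) (hr : 2 ≤ r) (hr' : Even r) :
    sub (upperTemplate r V) = (r / 2 + 1) ^ (Nat.card V).choose 2 := by
  have := nontrivial_of_three_le_card hV
  have := Fintype.ofFinite {A : Finset V // A.card = 2}
  rw [sub_eq_prod]
  simp_rw [allowed_upperTemplate, ncard_upperHalf hr hr']
  rw [Finset.prod_const, Finset.card_univ, ← Nat.card_eq_fintype_card, card_pairs]

variable {M : (templateLanguage 2 (metricClass r)).Structure V}

theorem sub_pos (hV : 3 ≤ Nat.card V) (hM : IsRandom M) : 0 < sub M := by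
  have := nontrivial_of_three_le_card hV
  have := Fintype.ofFinite {A : Finset V // A.card = 2}
  rw [sub_eq_prod]
  exact Finset.prod_pos fun A _ => (Set.ncard_pos (Set.toFinite _)).2 ((isRandom_iff.1 hM).1 A)

/-- The bound fails pair by pair, since one pair may allow more than `r / 2 + 1` distances; it holds
on average over each triangle. A triangle with all three sizes equal to `r / 2 + 1` has no bad pair.
Any other triangle loses `3 * logGap`, enough to charge `logGap` to each of its pairs, bad or not.
-/
theorem log_sub_le (hV : 3 ≤ Nat.card V) (hr : 2 ≤ r) (hr' : Even r) (hM : IsRandom M) :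
    Real.log (sub M) ≤ (Nat.card V).choose 2 * Real.log (r / 2 + 1 : ℕ) -
      logGap (r / 2 + 1) * (badPairs M).ncard := by
  classical
  have := nontrivial_of_three_le_card hV
  have := Fintype.ofFinite V
  have hne := (isRandom_iff.1 hM).1
  have hpos (A) : 1 ≤ (allowed M A).ncard := (Set.ncard_pos (Set.toFinite _)).2 (hne A)
  have ht : 2 ≤ r / 2 + 1 := by omega
  have hgap := logGap_pos ht
  let t := r / 2 + 1
  let w : {A : Finset V // A.card = 2} → ℝ := fun A =>
    Real.log t - Real.log (allowed M A).ncard - if A ∈ badPairs M then logGap t else 0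
  have good {A} (h : A ∉ badPairs M) : w A = 0 := by
    have h' : allowed M A = upperHalf r := not_not.1 h
    simp [w, h, h', ncard_upperHalf hr hr', t]
  have lower (A) : Real.log t - Real.log (allowed M A).ncard - logGap t ≤ w A := by
    simp only [w]
    split_ifs <;> linarith
  have hw : 0 ≤ ∑ A, w A := by
    refine sum_pairs_nonneg_of_triangles w (by rwa [← Nat.card_eq_fintype_card])
      fun x y z hxy hyz hxz => ?_
    have hT : TriangleSets (allowed M (pair x y hxy)) (allowed M (pair y z hyz))
        (allowed M (pair x z hxz)) := by
      intro i hi j hj k hk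
      refine ⟨?_, ?_, hM.triangle hxy hyz hxz hk hi hj⟩
      · rw [← pair_comm hyz] at hj
        have := hM.triangle hxz hyz.symm hxy hi hk hj
        omega
      · rw [← pair_comm hxy] at hi
        exact hM.triangle hxy.symm hxz hyz hj hi hk
    obtain ⟨hsum, heq⟩ := hT.ncard_le (hne _) (hne _) (hne _) hr'
    by_cases h : (allowed M (pair x y hxy)).ncard = t ∧ (allowed M (pair y z hyz)).ncard = t ∧
        (allowed M (pair x z hxz)).ncard = t
    · obtain ⟨h1, h2, h3⟩ := heq h.1 h.2.1 h.2.2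
      rw [good (not_not.2 h1), good (not_not.2 h2), good (not_not.2 h3)]
      norm_num
    · have := log_add_log_add_log_le ht (hpos _) (hpos _) (hpos _) hsum h
      linarith [lower (pair x y hxy), lower (pair y z hyz), lower (pair x z hxz)]
  have hlog : Real.log (sub M) = ∑ A, Real.log (allowed M A).ncard := by
    rw [sub_eq_prod, Nat.cast_prod, Real.log_prod]
    intro A _
    exact_mod_cast Nat.one_le_iff_ne_zero.1 (hpos A)
  have hbad : ∑ A, (if A ∈ badPairs M then logGap t else 0) =
      logGap t * (badPairs M).ncard := by
    rw [← Finset.sum_filter, Finset.sum_const, nsmul_eq_mul, mul_comm, Set.ncard_eq_toFinset_card']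
    congr 3
    ext A
    simp
  simp only [w, Finset.sum_sub_distrib] at hw
  rw [← hlog, hbad, Finset.sum_const, Finset.card_univ, ← Nat.card_eq_fintype_card, card_pairs,
    nsmul_eq_mul] at hw
  linarith

theorem sub_le (hV : 3 ≤ Nat.card V) (hr : 2 ≤ r) (hr' : Even r) (hM : IsRandom M) :
    sub M ≤ (r / 2 + 1) ^ (Nat.card V).choose 2 := by
  have h := log_sub_le hV hr hr' hM
  have hgap := logGap_pos (t := r / 2 + 1) (by omega)
  have h0 : 0 ≤ logGap (r / 2 + 1) * (badPairs M).ncard := by positivity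
  have h1 : Real.log (sub M) ≤ Real.log ((r / 2 + 1 : ℕ) ^ (Nat.card V).choose 2 : ℝ) := by
    rw [Real.log_pow]
    linarith
  have hs : (0 : ℝ) < sub M := by exact_mod_cast sub_pos hV hM
  exact_mod_cast (Real.log_le_log_iff hs (by positivity)).1 h1

theorem ex_eq {n : ℕ} (hn : 3 ≤ n) (hr : 2 ≤ r) (hr' : Even r) :
    ex 2 (metricClass r) n = (r / 2 + 1) ^ n.choose 2 := by
  refine IsGreatest.csSup_eq ⟨?_, ?_⟩
  · have hV : 3 ≤ Nat.card (Fin n) := by rwa [Nat.card_fin]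
    have := nontrivial_of_three_le_card hV
    refine ⟨Fin n, upperTemplate r (Fin n), inferInstance, Nat.card_fin n,
      upperTemplate_mem_randomTemplates (by omega) hr', ?_⟩
    rw [sub_upperTemplate hV hr hr', Nat.card_fin]
  · rintro s ⟨W, M, hW, rfl, hM, rfl⟩
    exact sub_le hn hr hr' hM.2

theorem extremalTemplates_eq (hV : 3 ≤ Nat.card V) (hr : 2 ≤ r) (hr' : Even r) :
    extremalTemplates 2 (metricClass r) V = {upperTemplate r V} := by
  have := nontrivial_of_three_le_card hV
  refine Set.eq_singleton_iff_unique_mem.2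
    ⟨⟨upperTemplate_mem_randomTemplates (by omega) hr', ?_⟩, ?_⟩
  · rw [sub_upperTemplate hV hr hr', ex_eq hV hr hr']
  · rintro M ⟨⟨hT, hR⟩, hM⟩
    have h := log_sub_le hV hr hr' hR
    have hgap := logGap_pos (t := r / 2 + 1) (by omega)
    rw [hM, ex_eq hV hr hr', Nat.cast_pow, Real.log_pow] at h
    -- Extremality leaves no room in `log_sub_le` for a positive multiple of the number of bad
    -- pairs.
    have h0 : ((badPairs M).ncard : ℝ) ≤ 0 := by
      by_contra hneg
      nlinarith
    have h1 : (badPairs M).ncard = 0 := by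
      have : (badPairs M).ncard ≤ 0 := by exact_mod_cast h0
      omega
    rw [Set.ncard_eq_zero (Set.toFinite _)] at h1
    refine hT.ext (isTemplate_upperTemplate (by omega)) fun A => ?_
    rw [allowed_upperTemplate]
    by_contra hA
    exact Set.eq_empty_iff_forall_notMem.1 h1 A hA

theorem ncard_diff_upperTemplate_le (hr : 2 ≤ r) (hM : IsTemplate M) :
    (diff 2 M (upperTemplate r V)).ncard ≤ (badPairs M).ncard := by
  rw [← Set.ncard_image_of_injective (badPairs M) Subtype.val_injective]
  refine Set.ncard_le_ncard (fun A hA => ?_) (Set.toFinite _)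
  obtain ⟨h, hne⟩ := hM.allowed_ne_of_mem_diff (isTemplate_upperTemplate (by omega)) hA
  rw [allowed_upperTemplate] at hne
  exact ⟨⟨A, h⟩, hne, rfl⟩

theorem hasStabilityTheorem_metricClass (hr : 2 ≤ r) (hr' : Even r) :
    HasStabilityTheorem (metricClass r) := by
  refine ⟨isNontrivial_metricClass (by omega), ?_⟩
  rw [maxArity_metricLanguage r (by omega)]
  intro δ hδ
  have hgap := logGap_pos (t := r / 2 + 1) (by omega)
  have hlog : 0 < Real.log (r / 2 + 1 : ℕ) :=
    Real.log_pos (by exact_mod_cast (by omega : 1 < r / 2 + 1))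
  -- With `t = r / 2 + 1`, a template with `sub ≥ ex ^ (1 - ε)` falls short of `C(n,2) log t` by at
  -- most `ε C(n,2) log t`, so `log_sub_le` bounds its bad pairs by `ε C(n,2) log t / logGap t`.
  -- This `ε` makes that `δ C(n,2)`. The threshold 2 provides the three points needed for triangles.
  refine ⟨δ * logGap (r / 2 + 1) / Real.log (r / 2 + 1 : ℕ), by positivity, 2, ?_⟩
  rintro n hn V hfin rfl M ⟨hT, hR⟩ hM
  refine ⟨upperTemplate r V, by rw [extremalTemplates_eq hn hr hr']; rfl, ?_⟩
  have hC : (0 : ℝ) < (Nat.card V).choose 2 := by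
    exact_mod_cast Nat.choose_pos (by omega : 2 ≤ Nat.card V)
  rw [strDist, div_le_iff₀ hC]
  have hd : ((diff 2 M (upperTemplate r V)).ncard : ℝ) ≤ (badPairs M).ncard := by
    exact_mod_cast ncard_diff_upperTemplate_le hr hT
  refine hd.trans ?_
  have h1 := log_sub_le hn hr hr' hR
  rw [ex_eq hn hr hr', Nat.cast_pow] at hM
  have hbase : (0 : ℝ) < ((r / 2 + 1 : ℕ) : ℝ) ^ (Nat.card V).choose 2 := by positivity
  have h2 := Real.log_le_log (by positivity) hM
  rw [Real.log_rpow hbase, Real.log_pow] at h2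
  have h3 : δ * logGap (r / 2 + 1) / Real.log (r / 2 + 1 : ℕ) *
      ((Nat.card V).choose 2 * Real.log (r / 2 + 1 : ℕ)) =
      logGap (r / 2 + 1) * (δ * (Nat.card V).choose 2) := by
    field_simp
  refine le_of_mul_le_mul_left ?_ hgap
  linarith

end Extremal

end HereditaryTemplates

theorem mainTheorem8 (r : ℕ) (hr : 2 ≤ r) (hr_even : Even r) :
    HereditaryTemplates.IsHereditaryProperty (HereditaryTemplates.metricClass r) ∧
    HereditaryTemplates.HasStabilityTheorem (HereditaryTemplates.metricClass r) ∧
    ∀ V : Type, Finite V → 3 ≤ Nat.card V →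
      ∃ T : (HereditaryTemplates.templateLanguage 2
          (HereditaryTemplates.metricClass r)).Structure V,
        HereditaryTemplates.extremalTemplates 2 (HereditaryTemplates.metricClass r) V = {T} ∧
        ∀ x y : V, x ≠ y →
          HereditaryTemplates.allowedDistances T x y = Set.Icc (r / 2) r := by
  refine ⟨HereditaryTemplates.isHereditaryProperty_metricClass r,
    HereditaryTemplates.hasStabilityTheorem_metricClass hr hr_even, fun V _ hV =>
    ⟨HereditaryTemplates.upperTemplate r V,
      HereditaryTemplates.extremalTemplates_eq hV hr hr_even, fun x y h => ?_⟩⟩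
  rw [HereditaryTemplates.allowedDistances_eq
    (HereditaryTemplates.isTemplate_upperTemplate (by omega)) h,
    HereditaryTemplates.allowed_upperTemplate, HereditaryTemplates.coe_image_upperHalf hr]
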